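/- Let $G=(V,E,c)$ be a finite connected undirected graph with at least two vertices and positive edge weights $c_e$. For a vertex $v$ let $c_v$ be the total weight of the edges joining $v$ to other vertices, and for $S\subseteq V$ let $\mathrm{vol}_G(S)=\sum_{v\in S}c_v$. Let $D$ be the diagonal matrix of the degrees $c_v$, let $L_G=D-A$ be the Laplacian, where $A$ is the weighted adjacency matrix, and let $\lambda_G$ be the smallest nonzero eigenvalue of the normalized Laplacian $D^{-1/2}L_GD^{-1/2}$. For disjoint nonempty sets $S_1,S_2\subseteq V$ let $H=G/(S_1,S_2)$ be the graph obtained from $G$ by contracting $S_1$ to a single vertex $s_1$ and $S_2$ to a single vertex $s_2$ (weights of parallel edges add up, self-loops are discarded), and let $$\mathrm{Reff}_G(S_1,S_2)=(\mathbf 1_{s_1}-\mathbf 1_{s_2})^{T}L_H^{\dagger}(\mathbf 1_{s_1}-\mathbf 1_{s_2})$$ be the effective resistance between $s_1$ and $s_2$ in $H$, where an edge of weight $c$ is a conductor of conductance $c$ and $\dagger$ denotes the Moore--Penrose pseudoinverse. Then there are disjoint nonempty sets $S_1,S_2\subseteq V$ with $$\mathrm{Reff}_G(S_1,S_2)\ \ge\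 \frac{1}{25600\,\lambda_G\,\min(\mathrm{vol}_G(S_1),\mathrm{vol}_G(S_2))}.$$ Furthermore, every pair of disjoint nonempty sets $S_1',S_2'\subseteq V$ satisfies $$\mathrm{Reff}_G(S_1',S_2')\ \le\ \frac{2}{\lambda_G\,\min(\mathrm{vol}_G(S_1'),\mathrm{vol}_G(S_2'))}.$$ -/

import Mathlib

open scoped Matrix

/-- A weighted undirected graph on `V`: `weight u v` is the (total) weight of the edge between
`u` and `v`, and it is `0` exactly if there is no such edge.  A self-loop contributes neither to
the degree of a vertex nor to the Laplacian, so the diagonal is normalised to `0`. -/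
structure WeightedGraph (V : Type*) where
  weight : V → V → ℝ
  symm : ∀ u v, weight u v = weight v u
  nonneg : ∀ u v, 0 ≤ weight u v
  loopless : ∀ v, weight v v = 0

/-- `X` is the Moore-Penrose pseudoinverse of the real matrix `M` (the four Penrose equations). -/
structure IsMoorePenroseInverse {n : Type*} [Fintype n] (M X : Matrix n n ℝ) : Prop where
  mul_mul_self : M * X * M = M
  mul_mul_inv : X * M * X = X
  symm_left : (M * X)ᵀ = M * X
  symm_right : (X * M)ᵀ = X * M

open Classical in
/-- The Moore-Penrose pseudoinverse of a real square matrix. -/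
noncomputable def pseudoinverse {n : Type*} [Fintype n] (M : Matrix n n ℝ) : Matrix n n ℝ :=
  if h : ∃ X, IsMoorePenroseInverse M X then h.choose else 0

/-- The Moore-Penrose pseudoinverse is unique. -/
theorem IsMoorePenroseInverse.unique {n : Type*} [Fintype n] {M X Y : Matrix n n ℝ}
    (hX : IsMoorePenroseInverse M X) (hY : IsMoorePenroseInverse M Y) : X = Y := by
  have h1 : M * X = M * Y := by
    calc M * X = (M * Y) * (M * X) := by rw [← mul_assoc, hY.mul_mul_self]
      _ = (M * Y)ᵀ * (M * X)ᵀ := by rw [hY.symm_left, hX.symm_left]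
      _ = (M * X * M * Y)ᵀ := by rw [← Matrix.transpose_mul]; simp only [mul_assoc]
      _ = M * Y := by rw [hX.mul_mul_self, hY.symm_left]
  have h2 : X * M = Y * M := by
    calc X * M = (X * M) * (Y * M) := by
          rw [mul_assoc, ← mul_assoc M, hY.mul_mul_self]
      _ = (X * M)ᵀ * (Y * M)ᵀ := by rw [hY.symm_right, hX.symm_right]
      _ = (Y * (M * X * M))ᵀ := by rw [← Matrix.transpose_mul]; simp only [mul_assoc]
      _ = Y * M := by rw [hX.mul_mul_self, hY.symm_right]
  calc X = X * M * X := hX.mul_mul_inv.symm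
    _ = Y * M * Y := by rw [h2, mul_assoc, h1, ← mul_assoc]
    _ = Y := hY.mul_mul_inv

/-- On symmetric matrices `pseudoinverse` is the Moore-Penrose pseudoinverse. -/
theorem isMoorePenroseInverse_pseudoinverse {n : Type*} [Fintype n] [DecidableEq n]
    {M : Matrix n n ℝ} (hM : M.IsSymm) : IsMoorePenroseInverse M (pseudoinverse M) := by
  have hex : ∃ X, IsMoorePenroseInverse M X := by
    have hH : M.IsHermitian := by
      rw [Matrix.IsHermitian, Matrix.conjTranspose_eq_transpose_of_trivial]; exact hM
    obtain ⟨U, d, hU, hMd⟩ : ∃ (U : Matrix n n ℝ) (d : n → ℝ), Uᵀ * U = 1 ∧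
        M = U * Matrix.diagonal d * Uᵀ := by
      refine ⟨hH.eigenvectorUnitary, hH.eigenvalues, ?_, ?_⟩
      · have := (Matrix.mem_unitaryGroup_iff').1 hH.eigenvectorUnitary.2
        rwa [Matrix.star_eq_conjTranspose, Matrix.conjTranspose_eq_transpose_of_trivial] at this
      · have := hH.spectral_theorem
        rw [Unitary.conjStarAlgAut_apply] at this
        rw [← Matrix.conjTranspose_eq_transpose_of_trivial, ← Matrix.star_eq_conjTranspose]
        exact this
    have key : ∀ a b : n → ℝ, (U * Matrix.diagonal a * Uᵀ) * (U * Matrix.diagonal b * Uᵀ)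
        = U * Matrix.diagonal (fun i => a i * b i) * Uᵀ := by
      intro a b
      calc _ = U * Matrix.diagonal a * (Uᵀ * U) * Matrix.diagonal b * Uᵀ := by
            simp only [mul_assoc]
        _ = _ := by rw [hU, mul_one, mul_assoc U, Matrix.diagonal_mul_diagonal]
    have tr : ∀ a : n → ℝ, (U * Matrix.diagonal a * Uᵀ)ᵀ = U * Matrix.diagonal a * Uᵀ := by
      intro a
      simp [Matrix.transpose_mul, mul_assoc]
    refine ⟨U * Matrix.diagonal (fun i => (d i)⁻¹) * Uᵀ, ?_, ?_, ?_, ?_⟩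
    · rw [hMd, key, key]; simp [mul_inv_mul_cancel]
    · have h : ∀ x : ℝ, x⁻¹ * x * x⁻¹ = x⁻¹ := fun x => by
        by_cases hx : x = 0
        · simp [hx]
        · field_simp
      rw [hMd, key, key]
      simp only [h]
    · rw [hMd, key, tr]
    · rw [hMd, key, tr]
  rw [pseudoinverse, dif_pos hex]
  exact hex.choose_spec

namespace WeightedGraph

/-- The simple graph formed by the edges of positive weight. -/
def support {V : Type*} (G : WeightedGraph V) : SimpleGraph V where
  Adj u v := 0 < G.weight u v
  symm := ⟨fun u v h => by rw [G.symm v u]; exact h⟩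
  loopless := ⟨fun v h => by rw [G.loopless v] at h; exact lt_irrefl _ h⟩

/-- A weighted graph is connected if its edges of positive weight connect all its vertices. -/
def Connected {V : Type*} (G : WeightedGraph V) : Prop := G.support.Connected

/-- The weighted degree of a vertex. -/
def degree {V : Type*} [Fintype V] (G : WeightedGraph V) (v : V) : ℝ := ∑ u, G.weight v u

/-- The volume of a set of vertices: the sum of their weighted degrees. -/
def vol {V : Type*} [Fintype V] (G : WeightedGraph V) (A : Finset V) : ℝ := ∑ v ∈ A, G.degree v

/-- The Laplacian matrix `L = D - A`. -/
def laplacian {V : Type*} [Fintype V] [DecidableEq V] (G : WeightedGraph V) : Matrix V V ℝ :=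
  Matrix.diagonal G.degree - Matrix.of G.weight

/-- The normalized Laplacian matrix `N = D^(-1/2) L D^(-1/2)`. -/
noncomputable def normalizedLaplacian {V : Type*} [Fintype V] [DecidableEq V]
    (G : WeightedGraph V) : Matrix V V ℝ :=
  Matrix.diagonal (fun v => (Real.sqrt (G.degree v))⁻¹) * G.laplacian *
    Matrix.diagonal (fun v => (Real.sqrt (G.degree v))⁻¹)

/-- The set of nonzero eigenvalues of the normalized Laplacian. -/
def nonzeroEigenvalues {V : Type*} [Fintype V] [DecidableEq V] (G : WeightedGraph V) : Set ℝ :=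
  {μ | μ ≠ 0 ∧ Module.End.HasEigenvalue (Matrix.toLin' G.normalizedLaplacian) μ}

/-- `λ_G`: the smallest nonzero eigenvalue of the normalized Laplacian. -/
noncomputable def lam {V : Type*} [Fintype V] [DecidableEq V] (G : WeightedGraph V) : ℝ :=
  sInf G.nonzeroEigenvalues

/-- The vertices of `G/(A,B)`: the vertices outside `A ∪ B`, and two new vertices
`a = Sum.inl false` and `b = Sum.inl true`. -/
abbrev ContractedVertex {V : Type*} (A B : Finset V) : Type _ :=
  Bool ⊕ {v : V // v ∉ A ∧ v ∉ B}

/-- The map that sends `A` to `a`, `B` to `b`, and every other vertex to itself. -/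
def contractMap {V : Type*} [DecidableEq V] (A B : Finset V) (v : V) : ContractedVertex A B :=
  if hA : v ∈ A then Sum.inl false
  else if hB : v ∈ B then Sum.inl true
  else Sum.inr ⟨v, hA, hB⟩

/-- The graph `G/(A,B)`: every edge `{u, v}` of `G` becomes an edge `{f u, f v}`; the weights
(conductances) of parallel edges add up and self-loops are dropped. -/
def contract {V : Type*} [Fintype V] [DecidableEq V] (G : WeightedGraph V) (A B : Finset V) :
    WeightedGraph (ContractedVertex A B) where
  weight p q := if p = q then 0 else
    ∑ u, ∑ v, if contractMap A B u = p ∧ contractMap A B v = q then G.weight u v else 0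
  symm p q := by
    by_cases h : p = q
    · rw [h]
    · rw [if_neg h, if_neg (Ne.symm h), Finset.sum_comm]
      refine Finset.sum_congr rfl fun u _ => Finset.sum_congr rfl fun v _ => ?_
      simp only [G.symm v u, and_comm]
  nonneg p q := by
    split_ifs
    · exact le_rfl
    · refine Finset.sum_nonneg fun u _ => Finset.sum_nonneg fun v _ => ?_
      split_ifs
      · exact G.nonneg u v
      · exact le_rfl
  loopless p := if_pos rfl

/-- The effective resistance between two vertices, `χ_stᵀ L† χ_st` with `χ_st = 1_s - 1_t`. -/
noncomputable def effectiveResistance {V : Type*} [Fintype V] [DecidableEq V]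
    (G : WeightedGraph V) (s t : V) : ℝ :=
  (Pi.single s 1 - Pi.single t 1 : V → ℝ) ⬝ᵥ
    (pseudoinverse G.laplacian *ᵥ (Pi.single s 1 - Pi.single t 1 : V → ℝ))

/-- `Reff_G(A, B)`: the effective resistance between `a` and `b` in `G/(A,B)`. -/
noncomputable def Reff {V : Type*} [Fintype V] [DecidableEq V] (G : WeightedGraph V)
    (A B : Finset V) : ℝ :=
  (G.contract A B).effectiveResistance (Sum.inl false) (Sum.inl true)

theorem laplacian_isSymm {V : Type*} [Fintype V] [DecidableEq V] (G : WeightedGraph V) :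
    G.laplacian.IsSymm := by
  ext u v
  by_cases h : u = v
  · subst h; rfl
  · simp [laplacian, Matrix.diagonal_apply_ne _ h, Matrix.diagonal_apply_ne' _ h, G.symm u v]

/-- In a connected graph with at least two vertices every degree is positive. -/
theorem degree_pos {V : Type*} [Fintype V] [Nontrivial V] (G : WeightedGraph V)
    (hG : G.Connected) (v : V) : 0 < G.degree v := by
  obtain ⟨u, hu⟩ := hG.preconnected.exists_adj_of_nontrivial v
  exact Finset.sum_pos' (fun w _ => G.nonneg v w) ⟨u, Finset.mem_univ u, hu⟩

/-- In a connected graph with at least two vertices, `λ_G` is indeed the least nonzero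
eigenvalue. -/
theorem isLeast_lam {V : Type*} [Fintype V] [DecidableEq V] [Nontrivial V]
    (G : WeightedGraph V) (hG : G.Connected) : IsLeast G.nonzeroEigenvalues G.lam := by
  have hfin : G.nonzeroEigenvalues.Finite :=
    (Module.End.finite_hasEigenvalue (Matrix.toLin' G.normalizedLaplacian)).subset fun _ h => h.2
  have hH : G.normalizedLaplacian.IsHermitian := by
    rw [Matrix.IsHermitian, Matrix.conjTranspose_eq_transpose_of_trivial, normalizedLaplacian,
      Matrix.transpose_mul, Matrix.transpose_mul, G.laplacian_isSymm.eq,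
      Matrix.diagonal_transpose, mul_assoc]
  have hne : G.normalizedLaplacian ≠ 0 := by
    intro h
    obtain ⟨v⟩ : Nonempty V := inferInstance
    have h1 := congrFun (congrFun h v) v
    have hd := G.degree_pos hG v
    rw [normalizedLaplacian, Matrix.mul_diagonal, Matrix.diagonal_mul] at h1
    simp [laplacian, G.loopless, hd.ne', (Real.sqrt_pos.2 hd).ne'] at h1
  have hnon : G.nonzeroEigenvalues.Nonempty := by
    obtain ⟨v, t, ht, hv, hvt⟩ := hH.exists_eigenvector_of_ne_zero hne
    refine ⟨t, ht, Module.End.hasEigenvalue_of_hasEigenvector (x := v) ⟨?_, hv⟩⟩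
    rw [Module.End.mem_eigenspace_iff, Matrix.toLin'_apply, hvt]
  exact ⟨hnon.csInf_mem hfin, fun _ h => csInf_le hfin.bddBelow h⟩

end WeightedGraph

/-! Both bounds compare `Reff` with the Rayleigh quotient of a function on `V`. By Dirichlet's
principle (`one_le_Reff_mul_energy`), a function equal to `1` on `S₁` and `0` on `S₂` with energy
`E` forces `Reff ≥ 1 / E`. Conversely, the potential of the unit current has energy and potential
drop both equal to `Reff` (`exists_energy_eq_Reff`).

Lower bound: let `L f = λ D f` and let `g` be the positive part of `f`, whose Rayleigh quotient is
at most `λ` (`energy_posPart_le`). Cut `g` at the heights `M / 2 ^ k`, where `M = max g`. The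
energies of the slices add up to at most that of `g`, while `∑ d g²` is at most the sum of `4 T² vol
{g ≥ T}` over the heights `T`. So some slice, between `τ` and `2τ`, has energy at most `16 λ τ² vol
{g ≥ 2τ}` (`exists_slice_energy_le`). Divided by `τ`, it is a test function for `S₁ = {g ≥ 2τ}` and
`S₂ = {g ≤ τ}`. Choosing the sign of `f` makes `S₁` the smaller side. This yields the constant `16`,
well below `25600`.

Upper bound: apply the Poincaré inequality to the potential, with values `a` on `S₁'` and `b` on
`S₂'`. It gives `λ m (a - b)² / 2 ≤ a - b` with `m` the smaller volume, and `a - b` is `Reff`. -/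

/-! ### Spectral gap of a symmetric matrix -/

/-- A symmetric matrix whose nonzero eigenvalues are at least `l` satisfies a spectral gap
inequality modulo its kernel. -/
theorem Matrix.IsHermitian.exists_ker_gap {n : Type*} [Fintype n] [DecidableEq n]
    {M : Matrix n n ℝ} (hM : M.IsHermitian) {l : ℝ}
    (hl : ∀ μ, μ ≠ 0 → Module.End.HasEigenvalue (Matrix.toLin' M) μ → l ≤ μ) (x : n → ℝ) :
    ∃ p : n → ℝ, M *ᵥ p = 0 ∧ l * ((x - p) ⬝ᵥ (x - p)) ≤ x ⬝ᵥ (M *ᵥ x) := by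
  obtain ⟨U, d, hU, hMd, hd⟩ : ∃ (U : Matrix n n ℝ) (d : n → ℝ), Uᵀ * U = 1 ∧
      M = U * Matrix.diagonal d * Uᵀ ∧ ∀ i, d i ≠ 0 → l ≤ d i := by
    refine ⟨hM.eigenvectorUnitary, hM.eigenvalues, ?_, ?_, ?_⟩
    · have := (Matrix.mem_unitaryGroup_iff').1 hM.eigenvectorUnitary.2
      rwa [Matrix.star_eq_conjTranspose, Matrix.conjTranspose_eq_transpose_of_trivial] at this
    · have := hM.spectral_theorem
      rw [Unitary.conjStarAlgAut_apply] at this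
      rw [← Matrix.conjTranspose_eq_transpose_of_trivial, ← Matrix.star_eq_conjTranspose]
      exact this
    · intro i hi
      refine hl _ hi (Module.End.hasEigenvalue_of_hasEigenvector
        (x := (hM.eigenvectorBasis i).ofLp) ⟨?_, ?_⟩)
      · rw [Module.End.mem_eigenspace_iff, Matrix.toLin'_apply]
        exact hM.mulVec_eigenvectorBasis i
      · intro h
        exact hM.eigenvectorBasis.toBasis.ne_zero i (by ext j; simpa using congrFun h j)
  have hU' : U * Uᵀ = 1 := mul_eq_one_comm.1 hU
  set y := Uᵀ *ᵥ x with hy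
  -- `q` keeps the coordinates with eigenvalue `0`, so `U *ᵥ q` is the orthogonal projection of `x`
  -- to the kernel.
  set q : n → ℝ := fun i => if d i = 0 then y i else 0 with hq
  have hx : x = U *ᵥ y := by rw [hy, Matrix.mulVec_mulVec, hU', Matrix.one_mulVec]
  have hiso : ∀ a b : n → ℝ, (U *ᵥ a) ⬝ᵥ (U *ᵥ b) = a ⬝ᵥ b := fun a b => by
    rw [Matrix.dotProduct_mulVec, Matrix.vecMul_mulVec, hU, Matrix.vecMul_one]
  have hMU : ∀ a : n → ℝ, M *ᵥ (U *ᵥ a) = U *ᵥ (Matrix.diagonal d *ᵥ a) := fun a => by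
    rw [Matrix.mulVec_mulVec, Matrix.mulVec_mulVec, hMd, mul_assoc, hU, mul_one]
  refine ⟨U *ᵥ q, ?_, ?_⟩
  · rw [hMU]
    have : Matrix.diagonal d *ᵥ q = 0 := by
      ext i
      simp only [Matrix.mulVec_diagonal, hq, Pi.zero_apply]
      split_ifs with h <;> simp [h]
    rw [this, Matrix.mulVec_zero]
  · rw [hx, hMU, ← Matrix.mulVec_sub, hiso, hiso]
    simp only [dotProduct, Matrix.mulVec_diagonal, Finset.mul_sum, Pi.sub_apply]
    refine Finset.sum_le_sum fun i _ => ?_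
    simp only [hq]
    split_ifs with h
    · simp [h]
    · have := mul_le_mul_of_nonneg_right (hd i h) (mul_self_nonneg (y i))
      rw [sub_zero]; linarith

/-! ### Dirichlet energy and the Laplacian form -/

namespace WeightedGraph

variable {V : Type*} [Fintype V]

/-- The Dirichlet energy of a function on the vertices. -/
noncomputable def energy (G : WeightedGraph V) (f : V → ℝ) : ℝ :=
  (∑ u, ∑ v, G.weight u v * (f u - f v) ^ 2) / 2

theorem energy_nonneg (G : WeightedGraph V) (f : V → ℝ) : 0 ≤ G.energy f :=
  div_nonneg (Finset.sum_nonneg fun u _ => Finset.sum_nonneg fun v _ =>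
    mul_nonneg (G.nonneg u v) (sq_nonneg _)) two_pos.le

theorem energy_mul_left (G : WeightedGraph V) (a : ℝ) (f : V → ℝ) :
    G.energy (fun v => a * f v) = a ^ 2 * G.energy f := by
  simp only [energy, Finset.mul_sum, mul_div_assoc', Finset.mul_sum]
  congr 1
  exact Finset.sum_congr rfl fun u _ => Finset.sum_congr rfl fun v _ => by ring

theorem eq_of_energy_eq_zero {G : WeightedGraph V} (hG : G.Connected) {f : V → ℝ}
    (hf : G.energy f = 0) (u v : V) : f u = f v := by
  have hn : ∀ u v, 0 ≤ G.weight u v * (f u - f v) ^ 2 :=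
    fun u v => mul_nonneg (G.nonneg u v) (sq_nonneg _)
  have h0 : ∀ u v, G.weight u v * (f u - f v) ^ 2 = 0 := by
    intro u v
    have h1 : ∑ u, ∑ v, G.weight u v * (f u - f v) ^ 2 = 0 := by
      rw [energy] at hf; linarith
    have h2 := (Finset.sum_eq_zero_iff_of_nonneg
      (fun u _ => Finset.sum_nonneg fun v _ => hn u v)).1 h1 u (Finset.mem_univ u)
    exact (Finset.sum_eq_zero_iff_of_nonneg (fun v _ => hn u v)).1 h2 v (Finset.mem_univ v)
  obtain ⟨p⟩ := hG.preconnected u v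
  induction p with
  | nil => rfl
  | cons h _ ih =>
    refine Eq.trans ?_ ih
    have h' : 0 < G.weight _ _ := h
    rcases mul_eq_zero.1 (h0 _ _) with h3 | h3
    · exact absurd h3 h'.ne'
    · exact sub_eq_zero.1 (pow_eq_zero_iff two_ne_zero |>.1 h3)

variable [DecidableEq V]

theorem laplacian_mulVec (G : WeightedGraph V) (f : V → ℝ) (u : V) :
    (G.laplacian *ᵥ f) u = ∑ v, G.weight u v * (f u - f v) := by
  rw [laplacian, Matrix.sub_mulVec, Pi.sub_apply, Matrix.mulVec_diagonal, degree]
  simp only [Matrix.mulVec, dotProduct, Matrix.of_apply, mul_sub, Finset.sum_sub_distrib,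
    Finset.sum_mul]

theorem dotProduct_laplacian_mulVec (G : WeightedGraph V) (g f : V → ℝ) :
    g ⬝ᵥ (G.laplacian *ᵥ f) =
      (∑ u, ∑ v, G.weight u v * ((g u - g v) * (f u - f v))) / 2 := by
  have h1 : g ⬝ᵥ (G.laplacian *ᵥ f) = ∑ u, ∑ v, G.weight u v * (g u * (f u - f v)) := by
    simp only [dotProduct, laplacian_mulVec, Finset.mul_sum]
    exact Finset.sum_congr rfl fun u _ => Finset.sum_congr rfl fun v _ => by ring
  have h2 : g ⬝ᵥ (G.laplacian *ᵥ f) = ∑ u, ∑ v, G.weight u v * (g v * (f v - f u)) := by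
    rw [h1, Finset.sum_comm]
    exact Finset.sum_congr rfl fun u _ => Finset.sum_congr rfl fun v _ => by rw [G.symm v u]
  rw [eq_div_iff two_ne_zero, mul_two]
  nth_rw 1 [h1]
  rw [h2, ← Finset.sum_add_distrib]
  refine Finset.sum_congr rfl fun u _ => ?_
  rw [← Finset.sum_add_distrib]
  exact Finset.sum_congr rfl fun v _ => by ring

theorem dotProduct_laplacian_mulVec_self (G : WeightedGraph V) (f : V → ℝ) :
    f ⬝ᵥ (G.laplacian *ᵥ f) = G.energy f := by
  rw [dotProduct_laplacian_mulVec, energy]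
  simp only [sq]

theorem dotProduct_laplacian_comm (G : WeightedGraph V) (g f : V → ℝ) :
    g ⬝ᵥ (G.laplacian *ᵥ f) = f ⬝ᵥ (G.laplacian *ᵥ g) := by
  simp only [dotProduct_laplacian_mulVec, mul_comm]

theorem energy_add_mul (G : WeightedGraph V) (g f : V → ℝ) (t : ℝ) :
    G.energy (f + t • g) =
      G.energy g * (t * t) + 2 * (g ⬝ᵥ (G.laplacian *ᵥ f)) * t + G.energy f := by
  simp only [← dotProduct_laplacian_mulVec_self, Matrix.mulVec_add, Matrix.mulVec_smul,
    dotProduct_add, add_dotProduct, smul_dotProduct, dotProduct_smul, smul_eq_mul,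
    G.dotProduct_laplacian_comm f g]
  ring

/-- Cauchy–Schwarz for the semidefinite form `L`: the quadratic `t ↦ energy (f + t • g)` is
nonnegative, so its discriminant is not positive. -/
theorem sq_dotProduct_laplacian_le (G : WeightedGraph V) (g f : V → ℝ) :
    (g ⬝ᵥ (G.laplacian *ᵥ f)) ^ 2 ≤ G.energy g * G.energy f := by
  have h := discrim_le_zero (a := G.energy g) (b := 2 * (g ⬝ᵥ (G.laplacian *ᵥ f)))
    (c := G.energy f) fun t => by rw [← energy_add_mul]; exact G.energy_nonneg _
  rw [discrim] at h
  linarith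

/-! ### Contraction -/

/-- Discarding self-loops costs nothing, since `φ p - φ q` vanishes for `p = q`. Hence energies in
`G/(A,B)` can be computed in `G`. -/
theorem energy_contract (G : WeightedGraph V) (A B : Finset V) (φ : ContractedVertex A B → ℝ) :
    (G.contract A B).energy φ = G.energy fun v => φ (contractMap A B v) := by
  rw [energy, energy]
  congr 1
  have h1 : ∀ p q : ContractedVertex A B, (G.contract A B).weight p q * (φ p - φ q) ^ 2 =
      ∑ u, ∑ v, if contractMap A B u = p then if contractMap A B v = q then
        G.weight u v * (φ p - φ q) ^ 2 else 0 else 0 := by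
    intro p q
    by_cases h : p = q
    · simp [h]
    · simp only [contract, if_neg h, Finset.sum_mul, ← ite_and, ite_mul, zero_mul]
  simp only [h1]
  calc _ = ∑ p : ContractedVertex A B, ∑ u, ∑ v, ∑ q : ContractedVertex A B,
        (if contractMap A B u = p then if contractMap A B v = q then
        G.weight u v * (φ p - φ q) ^ 2 else 0 else 0) := by
        refine Finset.sum_congr rfl fun p _ => ?_
        rw [Finset.sum_comm]
        exact Finset.sum_congr rfl fun u _ => Finset.sum_comm
    _ = ∑ u, ∑ v, ∑ p : ContractedVertex A B, ∑ q : ContractedVertex A B,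
        (if contractMap A B u = p then if contractMap A B v = q then
        G.weight u v * (φ p - φ q) ^ 2 else 0 else 0) := by
        rw [Finset.sum_comm]
        exact Finset.sum_congr rfl fun u _ => Finset.sum_comm
    _ = _ := by
        refine Finset.sum_congr rfl fun u _ => Finset.sum_congr rfl fun v _ => ?_
        rw [Finset.sum_eq_single (contractMap A B u), Finset.sum_eq_single (contractMap A B v)]
        · simp
        · intro q _ hq; simp [hq.symm]
        · simp
        · intro p _ hp; simp [hp.symm]
        · simp

theorem contractMap_of_mem_left {U : Type*} [DecidableEq U] {A : Finset U}
    (B : Finset U) {v : U} (hv : v ∈ A) :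
    contractMap A B v = Sum.inl false := by simp [contractMap, hv]

theorem contractMap_of_mem_right {U : Type*} [DecidableEq U]
    {A B : Finset U} (hAB : Disjoint A B) {v : U} (hv : v ∈ B) :
    contractMap A B v = Sum.inl true := by
  simp [contractMap, hv, Finset.disjoint_right.1 hAB hv]

theorem contractMap_surjective {U : Type*} [DecidableEq U]
    {A B : Finset U} (hA : A.Nonempty) (hB : B.Nonempty)
    (hAB : Disjoint A B) : Function.Surjective (contractMap A B) := by
  rintro ((_ | _) | ⟨v, hvA, hvB⟩)
  · exact hA.imp fun v hv => contractMap_of_mem_left B hv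
  · exact hB.imp fun v hv => contractMap_of_mem_right hAB hv
  · exact ⟨v, by simp [contractMap, hvA, hvB]⟩

/-! ### Effective resistance -/

/-- The potential of the unit current flow is `L† χ`: it solves `L φ = χ` as soon as the only
functions of zero energy are the constants. -/
theorem laplacian_mulVec_pseudoinverse (G : WeightedGraph V)
    (hG : ∀ f : V → ℝ, G.energy f = 0 → ∀ u v, f u = f v) (s t : V) :
    G.laplacian *ᵥ (pseudoinverse G.laplacian *ᵥ (Pi.single s 1 - Pi.single t 1 : V → ℝ)) =
      Pi.single s 1 - Pi.single t 1 := by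
  have hP := isMoorePenroseInverse_pseudoinverse G.laplacian_isSymm
  set L := G.laplacian with hL
  set X := pseudoinverse L
  set χ : V → ℝ := Pi.single s 1 - Pi.single t 1 with hχ
  have hLLX : L * (L * X) = L := by
    have := congrArg Matrix.transpose hP.mul_mul_self
    rwa [Matrix.transpose_mul, hP.symm_left, G.laplacian_isSymm.eq] at this
  -- The residual `r` is killed by `L`, hence constant and orthogonal to `χ`. It is also orthogonal
  -- to the range of `L`, so `r ⬝ᵥ r = 0`.
  set r := χ - L *ᵥ (X *ᵥ χ) with hr
  have hLr : L *ᵥ r = 0 := by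
    rw [hr, Matrix.mulVec_sub, Matrix.mulVec_mulVec, Matrix.mulVec_mulVec, mul_assoc, hLLX, sub_self]
  have hconst := hG r (by rw [← dotProduct_laplacian_mulVec_self, ← hL, hLr, dotProduct_zero])
  have hrχ : r ⬝ᵥ χ = 0 := by
    rw [hχ, dotProduct_sub, dotProduct_single_one, dotProduct_single_one, hconst s t, sub_self]
  have hrr : r ⬝ᵥ r = 0 := by
    nth_rw 2 [hr]
    rw [dotProduct_sub, hrχ, dotProduct_laplacian_comm, ← hL, hLr, dotProduct_zero, sub_zero]
  exact (sub_eq_zero.1 (dotProduct_self_eq_zero.1 hrr)).symm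

theorem exists_potential (G : WeightedGraph V)
    (hG : ∀ f : V → ℝ, G.energy f = 0 → ∀ u v, f u = f v) (s t : V) :
    ∃ φ : V → ℝ, G.laplacian *ᵥ φ = Pi.single s 1 - Pi.single t 1 ∧
      G.effectiveResistance s t = φ s - φ t ∧ G.energy φ = φ s - φ t := by
  have h := G.laplacian_mulVec_pseudoinverse hG s t
  refine ⟨_, h, ?_, ?_⟩
  · rw [effectiveResistance, sub_dotProduct, single_one_dotProduct, single_one_dotProduct]
  · rw [← dotProduct_laplacian_mulVec_self, h, dotProduct_sub, dotProduct_single_one,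
      dotProduct_single_one]

/-- Pulling `φ` back to `G` transfers rigidity to the contraction, so connectedness of `G/(A,B)`
itself is not needed. -/
theorem energy_contract_eq_zero {G : WeightedGraph V} (hG : G.Connected) {A B : Finset V}
    (hA : A.Nonempty) (hB : B.Nonempty) (hAB : Disjoint A B) (φ : ContractedVertex A B → ℝ)
    (hφ : (G.contract A B).energy φ = 0) (p q : ContractedVertex A B) : φ p = φ q := by
  obtain ⟨u, rfl⟩ := contractMap_surjective hA hB hAB p
  obtain ⟨v, rfl⟩ := contractMap_surjective hA hB hAB q
  rw [energy_contract] at hφ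
  exact eq_of_energy_eq_zero hG hφ u v

/-- Thomson-type description of `Reff`: it is the potential difference and the energy of some
function that is constant on `A` and on `B`. -/
theorem exists_energy_eq_Reff {G : WeightedGraph V} (hG : G.Connected) {A B : Finset V}
    (hA : A.Nonempty) (hB : B.Nonempty) (hAB : Disjoint A B) :
    ∃ (f : V → ℝ) (a b : ℝ), (∀ v ∈ A, f v = a) ∧ (∀ v ∈ B, f v = b) ∧
      G.Reff A B = a - b ∧ G.energy f = a - b := by
  obtain ⟨φ, -, hR, hE⟩ := (G.contract A B).exists_potential
    (energy_contract_eq_zero hG hA hB hAB) (Sum.inl false) (Sum.inl true)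
  refine ⟨fun v => φ (contractMap A B v), φ (Sum.inl false), φ (Sum.inl true), ?_, ?_, hR, ?_⟩
  · intro v hv; simp only [contractMap_of_mem_left B hv]
  · intro v hv; simp only [contractMap_of_mem_right hAB hv]
  · rw [← energy_contract, hE]

/-- Dirichlet's principle, as a lower bound for `Reff`. -/
theorem one_le_Reff_mul_energy {G : WeightedGraph V} (hG : G.Connected) {A B : Finset V}
    (hA : A.Nonempty) (hB : B.Nonempty) (hAB : Disjoint A B) {f : V → ℝ}
    (hfA : ∀ v ∈ A, f v = 1) (hfB : ∀ v ∈ B, f v = 0) : 1 ≤ G.Reff A B * G.energy f := by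
  obtain ⟨φ, hφ, hR, hE⟩ := (G.contract A B).exists_potential
    (energy_contract_eq_zero hG hA hB hAB) (Sum.inl false) (Sum.inl true)
  -- `h` is `f` descended to the contraction. Pairing it with `L φ = χ` gives `1`, so Cauchy–Schwarz
  -- bounds `1` by the energy of `f` times that of `φ`, and the latter is `Reff`.
  set h : ContractedVertex A B → ℝ := Sum.elim (fun b => if b then 0 else 1) fun v => f v with hh
  have hf : (fun v => h (contractMap A B v)) = f := by
    funext v
    by_cases hvA : v ∈ A
    · simp [contractMap_of_mem_left B hvA, hh, hfA v hvA]
    · by_cases hvB : v ∈ B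
      · simp [contractMap_of_mem_right hAB hvB, hh, hfB v hvB]
      · simp [contractMap, hvA, hvB, hh]
  have hCS := (G.contract A B).sq_dotProduct_laplacian_le h φ
  rw [hφ, dotProduct_sub, dotProduct_single_one, dotProduct_single_one, energy_contract, hf, hE,
    ← hR] at hCS
  have h1 : h (Sum.inl false) - h (Sum.inl true) = 1 := by simp [hh]
  rw [h1, one_pow, mul_comm] at hCS
  exact hCS

end WeightedGraph

/-! ### Dyadic truncation -/

theorem monotone_min_sub_min {p q : ℝ} (h : q ≤ p) : Monotone fun a : ℝ => min a p - min a q := by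
  intro a b hab
  simp only
  rcases le_total a p with h1 | h1 <;> rcases le_total a q with h2 | h2 <;>
    rcases le_total b p with h3 | h3 <;> rcases le_total b q with h4 | h4 <;>
    simp only [min_eq_left, min_eq_right, h1, h2, h3, h4] <;> linarith

/-- The slices of the real line between consecutive members of an antitone sequence contribute
at most `(a - b) ^ 2` in total. -/
theorem sum_sq_slice_le {T : ℕ → ℝ} (hT : Antitone T) (n : ℕ) (a b : ℝ) :
    ∑ k ∈ Finset.range n, ((min a (T k) - min a (T (k + 1))) -
      (min b (T k) - min b (T (k + 1)))) ^ 2 ≤ (a - b) ^ 2 := by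
  wlog hab : b ≤ a generalizing a b
  · refine le_trans (Finset.sum_le_sum fun k _ => ?_) ((this b a (le_of_not_ge hab)).trans ?_)
    · exact le_of_eq (by ring)
    · exact le_of_eq (by ring)
  -- All slice differences have the same sign, so the sum of squares is at most the square of the
  -- sum, which telescopes.
  have hpos : ∀ k, 0 ≤ (min a (T k) - min a (T (k + 1))) - (min b (T k) - min b (T (k + 1))) :=
    fun k => sub_nonneg.2 (monotone_min_sub_min (hT (Nat.le_succ k)) hab)
  refine (Finset.sum_sq_le_sq_sum_of_nonneg fun k _ => hpos k).trans
    (pow_le_pow_left₀ (Finset.sum_nonneg fun k _ => hpos k) ?_ 2)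
  rw [Finset.sum_sub_distrib, Finset.sum_range_sub', Finset.sum_range_sub']
  have h1 : min b (T n) ≤ min a (T n) := min_le_min_right _ hab
  have h2 : min a (T 0) - min b (T 0) ≤ a - b := by
    rcases le_total a (T 0) with h3 | h3 <;> rcases le_total b (T 0) with h4 | h4 <;>
      simp only [min_eq_left, min_eq_right, h3, h4] <;> linarith
  linarith

/-- Dyadic layer-cake bound for the square. -/
theorem sq_le_sum_dyadic {M a : ℝ} (hM : 0 < M) (ha : 0 ≤ a) (haM : a ≤ M) (n : ℕ) :
    a ^ 2 ≤ ∑ k ∈ Finset.range (n + 1), (if M / 2 ^ k ≤ a then 4 * (M / 2 ^ k) ^ 2 else 0) ∨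
      a < M / 2 ^ n := by
  induction n with
  | zero =>
    rcases lt_or_ge a M with h | h
    · right; simpa using h
    · left
      simp only [zero_add, Finset.sum_range_one, pow_zero, div_one, if_pos h]
      nlinarith
  | succ n ih =>
    rw [Finset.sum_range_succ]
    have hterm : ∀ k, 0 ≤ (if M / 2 ^ k ≤ a then 4 * (M / 2 ^ k) ^ 2 else 0) := fun k => by
      split_ifs <;> positivity
    rcases ih with h | h
    · left; linarith [hterm (n + 1)]
    · rcases lt_or_ge a (M / 2 ^ (n + 1)) with h1 | h1
      · right; exact h1
      · left
        rw [if_pos h1]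
        -- The first level that `a` reaches is more than half of `a`, so its term alone dominates `a
        -- ^ 2`.
        have h2 : M / 2 ^ n = 2 * (M / 2 ^ (n + 1)) := by rw [pow_succ]; field_simp
        have h3 := pow_le_pow_left₀ ha (h.le.trans_eq h2) 2
        have h4 := Finset.sum_nonneg fun k (_ : k ∈ Finset.range (n + 1)) => hterm k
        linarith

/-! ### Choice of a threshold -/

namespace WeightedGraph

variable {V : Type*} [Fintype V]

theorem sum_energy_slice_le (G : WeightedGraph V) {T : ℕ → ℝ} (hT : Antitone T) (n : ℕ)
    (g : V → ℝ) : ∑ k ∈ Finset.range n, G.energy (fun v => min (g v) (T k) -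
      min (g v) (T (k + 1))) ≤ G.energy g := by
  simp only [energy]
  rw [← Finset.sum_div, Finset.sum_comm]
  refine div_le_div_of_nonneg_right (Finset.sum_le_sum fun u _ => ?_) two_pos.le
  rw [Finset.sum_comm]
  refine Finset.sum_le_sum fun v _ => ?_
  rw [← Finset.mul_sum]
  exact mul_le_mul_of_nonneg_left (sum_sq_slice_le hT n _ _) (G.nonneg u v)

theorem degree_nonneg (G : WeightedGraph V) (v : V) : 0 ≤ G.degree v :=
  Finset.sum_nonneg fun u _ => G.nonneg v u

theorem vol_mono (G : WeightedGraph V) {A B : Finset V} (h : A ⊆ B) : G.vol A ≤ G.vol B :=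
  Finset.sum_le_sum_of_subset_of_nonneg h fun v _ _ => G.degree_nonneg v

/-- Some dyadic slice of a nonnegative function has small energy compared to the volume of the
set above it. -/
theorem exists_slice_energy_le (G : WeightedGraph V) {l : ℝ} (hl : 0 ≤ l) {g : V → ℝ}
    (hg : ∀ v, 0 ≤ g v) {w : V} (hw : 0 < g w)
    (hE : G.energy g ≤ l * ∑ v, G.degree v * g v ^ 2) :
    ∃ τ : ℝ, 0 < τ ∧ (∃ v, 2 * τ ≤ g v) ∧
      G.energy (fun v => min (g v) (2 * τ) - min (g v) τ) ≤
        16 * l * τ ^ 2 * G.vol {v | 2 * τ ≤ g v} := by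
  obtain ⟨m, -, hm⟩ := Finset.exists_max_image Finset.univ g ⟨w, Finset.mem_univ w⟩
  set M := g m
  have hM : 0 < M := hw.trans_le (hm w (Finset.mem_univ w))
  set T : ℕ → ℝ := fun k => M / 2 ^ k with hT
  have hTpos : ∀ k, 0 < T k := fun k => by positivity
  have hT2 : ∀ k, T k = 2 * T (k + 1) := fun k => by
    simp only [hT]; rw [pow_succ]; field_simp
  have hTanti : Antitone T := antitone_nat_of_succ_le fun k => by
    rw [hT2 k]; linarith [hTpos (k + 1)]
  have hTlim : Filter.Tendsto T Filter.atTop (nhds 0) := by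
    have := (tendsto_pow_atTop_nhds_zero_of_lt_one (r := (1 / 2 : ℝ)) (by norm_num)
      (by norm_num)).const_mul M
    rw [mul_zero] at this
    refine this.congr fun k => ?_
    simp only [hT]; rw [one_div, inv_pow, div_eq_mul_inv]
  -- A level below every positive value of `g` excludes the second alternative of
  -- `sq_le_sum_dyadic`.
  obtain ⟨n, hn⟩ : ∃ n, ∀ v, 0 < g v → T n < g v := by
    have : ∀ᶠ n in Filter.atTop, ∀ v, 0 < g v → T n < g v := by
      rw [Filter.eventually_all]
      intro v
      rcases lt_or_ge 0 (g v) with h | h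
      · filter_upwards [hTlim.eventually_lt_const h] with k hk _ using hk
      · exact Filter.Eventually.of_forall fun k hk => absurd hk h.not_gt
    exact this.exists
  have hlayer : ∑ v, G.degree v * g v ^ 2 ≤
      ∑ k ∈ Finset.range (n + 1), 4 * T k ^ 2 * G.vol {v | T k ≤ g v} := by
    calc _ ≤ ∑ v, G.degree v *
          ∑ k ∈ Finset.range (n + 1), (if T k ≤ g v then 4 * T k ^ 2 else 0) := by
          refine Finset.sum_le_sum fun v _ => mul_le_mul_of_nonneg_left ?_ (G.degree_nonneg v)
          rcases (hg v).eq_or_lt with h | h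
          · rw [← h, zero_pow two_ne_zero]
            exact Finset.sum_nonneg fun k _ => by split_ifs <;> positivity
          · exact (sq_le_sum_dyadic hM (hg v) (hm v (Finset.mem_univ v)) n).resolve_right
              (hn v h).not_gt
      _ = _ := by
          simp only [Finset.mul_sum, vol, Finset.sum_filter]
          rw [Finset.sum_comm]
          refine Finset.sum_congr rfl fun k _ => Finset.sum_congr rfl fun v _ => ?_
          split_ifs <;> ring
  by_contra! hcon
  have hlt : ∀ k, 4 * l * T k ^ 2 * G.vol {v | T k ≤ g v} <
      G.energy (fun v => min (g v) (T k) - min (g v) (T (k + 1))) := by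
    intro k
    have h0 : T k ≤ g m := by
      simpa [hT, M] using hTanti (Nat.zero_le k)
    -- With `τ = T (k + 1)` one has `16 τ² = 4 (T k)²`, matching the layer-cake term. Summing the
    -- strict inequalities contradicts `hE`.
    have := hcon (T (k + 1)) (hTpos _) ⟨m, by rw [← hT2]; exact h0⟩
    rw [← hT2] at this
    refine lt_of_eq_of_lt ?_ this
    rw [hT2 k]; ring
  have hsum := Finset.sum_lt_sum_of_nonempty (s := Finset.range (n + 1)) ⟨0, by simp⟩
    fun k _ => hlt k
  have h1 := G.sum_energy_slice_le hTanti (n + 1) g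
  have h2 := mul_le_mul_of_nonneg_left hlayer hl
  rw [Finset.mul_sum (Finset.range (n + 1))] at h2
  have h3 : ∑ k ∈ Finset.range (n + 1), l * (4 * T k ^ 2 * G.vol {v | T k ≤ g v}) =
      ∑ k ∈ Finset.range (n + 1), 4 * l * T k ^ 2 * G.vol {v | T k ≤ g v} :=
    Finset.sum_congr rfl fun k _ => by ring
  linarith

theorem exists_pos_and_nonpos [Nontrivial V] {G : WeightedGraph V} (hG : G.Connected) {f : V → ℝ}
    (hf : f ≠ 0) (hsum : ∑ v, G.degree v * f v = 0) : (∃ v, 0 < f v) ∧ ∃ v, f v ≤ 0 := by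
  constructor
  · by_contra! h
    refine hf (funext fun v => ?_)
    have := (Finset.sum_eq_zero_iff_of_nonpos fun v _ =>
      mul_nonpos_of_nonneg_of_nonpos (G.degree_nonneg v) (h v)).1 hsum v (Finset.mem_univ v)
    exact (mul_eq_zero.1 this).resolve_left (G.degree_pos hG v).ne'
  · by_contra! h
    exact (Finset.sum_pos (fun v _ => mul_pos (G.degree_pos hG v) (h v))
      Finset.univ_nonempty).ne' hsum

variable [DecidableEq V]

/-! ### The normalized Laplacian -/

theorem normalizedLaplacian_isHermitian (G : WeightedGraph V) :
    G.normalizedLaplacian.IsHermitian := by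
  rw [Matrix.IsHermitian, Matrix.conjTranspose_eq_transpose_of_trivial, normalizedLaplacian,
    Matrix.transpose_mul, Matrix.transpose_mul, G.laplacian_isSymm.eq,
    Matrix.diagonal_transpose, mul_assoc]

theorem normalizedLaplacian_mulVec (G : WeightedGraph V) (x : V → ℝ) (v : V) :
    (G.normalizedLaplacian *ᵥ x) v = (Real.sqrt (G.degree v))⁻¹ *
      (G.laplacian *ᵥ fun u => (Real.sqrt (G.degree u))⁻¹ * x u) v := by
  rw [normalizedLaplacian, ← Matrix.mulVec_mulVec, ← Matrix.mulVec_mulVec, Matrix.mulVec_diagonal]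
  congr 3
  ext u
  rw [Matrix.mulVec_diagonal]

theorem dotProduct_normalizedLaplacian_mulVec (G : WeightedGraph V) (x : V → ℝ) :
    x ⬝ᵥ (G.normalizedLaplacian *ᵥ x) =
      G.energy fun u => (Real.sqrt (G.degree u))⁻¹ * x u := by
  rw [← dotProduct_laplacian_mulVec_self]
  refine Finset.sum_congr rfl fun v _ => ?_
  rw [normalizedLaplacian_mulVec]; ring

/-- Test the eigenvalue equation against the positive part `g`: `gᵀ L f = λ ∑ d g²`, and edge by
edge `(g u - g v)² ≤ (g u - g v) (f u - f v)`. -/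
theorem energy_posPart_le {G : WeightedGraph V} {f : V → ℝ}
    (hLf : ∀ v, (G.laplacian *ᵥ f) v = G.lam * (G.degree v * f v)) :
    G.energy (fun v => max (f v) 0) ≤ G.lam * ∑ v, G.degree v * max (f v) 0 ^ 2 := by
  have h1 : (fun v => max (f v) 0) ⬝ᵥ (G.laplacian *ᵥ f) =
      G.lam * ∑ v, G.degree v * max (f v) 0 ^ 2 := by
    rw [Finset.mul_sum]
    refine Finset.sum_congr rfl fun v _ => ?_
    rw [hLf]
    rcases le_total (f v) 0 with h | h
    · simp [max_eq_right h]
    · simp only [max_eq_left h]; ring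
  rw [← h1, dotProduct_laplacian_mulVec, energy]
  refine div_le_div_of_nonneg_right (Finset.sum_le_sum fun u _ => Finset.sum_le_sum fun v _ =>
    mul_le_mul_of_nonneg_left ?_ (G.nonneg u v)) two_pos.le
  rcases le_total (f u) 0 with h | h <;> rcases le_total (f v) 0 with h' | h' <;>
    simp only [max_eq_left, max_eq_right, h, h'] <;> nlinarith

variable [Nontrivial V]

/-- Poincaré inequality. -/
theorem exists_lam_mul_le_energy {G : WeightedGraph V} (hG : G.Connected) (f : V → ℝ) :
    ∃ c : ℝ, G.lam * ∑ v, G.degree v * (f v - c) ^ 2 ≤ G.energy f := by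
  have hs : ∀ v, Real.sqrt (G.degree v) ≠ 0 := fun v => (Real.sqrt_pos.2 (G.degree_pos hG v)).ne'
  obtain ⟨p, hp, hgap⟩ := G.normalizedLaplacian_isHermitian.exists_ker_gap
    (fun μ h0 h => (G.isLeast_lam hG).2 ⟨h0, h⟩) (fun v => Real.sqrt (G.degree v) * f v)
  rw [dotProduct_normalizedLaplacian_mulVec] at hgap
  simp only [inv_mul_cancel_left₀ (hs _)] at hgap
  have hconst := eq_of_energy_eq_zero hG (f := fun u => (Real.sqrt (G.degree u))⁻¹ * p u)
    (by rw [← dotProduct_normalizedLaplacian_mulVec, hp, dotProduct_zero])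
  obtain ⟨w⟩ : Nonempty V := inferInstance
  refine ⟨(Real.sqrt (G.degree w))⁻¹ * p w, le_of_eq_of_le ?_ hgap⟩
  congr 1
  refine Finset.sum_congr rfl fun v _ => ?_
  -- The kernel vector `p` is a multiple of `D^(1/2) 1`. The constant `c` is that multiple.
  have hpv : p v = Real.sqrt (G.degree v) * ((Real.sqrt (G.degree w))⁻¹ * p w) := by
    rw [← hconst v w, mul_inv_cancel_left₀ (hs v)]
  rw [Pi.sub_apply, hpv, ← mul_sub]
  nth_rw 1 [← Real.mul_self_sqrt (G.degree_nonneg v)]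
  ring

theorem exists_eigenfunction {G : WeightedGraph V} (hG : G.Connected) :
    ∃ f : V → ℝ, f ≠ 0 ∧ ∀ v, (G.laplacian *ᵥ f) v = G.lam * (G.degree v * f v) := by
  have hs : ∀ v, Real.sqrt (G.degree v) ≠ 0 := fun v => (Real.sqrt_pos.2 (G.degree_pos hG v)).ne'
  obtain ⟨x, hx, hx0⟩ := (G.isLeast_lam hG).1.2.exists_hasEigenvector
  rw [Module.End.mem_eigenspace_iff, Matrix.toLin'_apply] at hx
  refine ⟨fun u => (Real.sqrt (G.degree u))⁻¹ * x u, ?_, fun v => ?_⟩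
  · intro h
    refine hx0 (funext fun v => ?_)
    exact (mul_eq_zero.1 (congrFun h v)).resolve_left (inv_ne_zero (hs v))
  · have h := congrFun hx v
    rw [normalizedLaplacian_mulVec, Pi.smul_apply, smul_eq_mul, inv_mul_eq_iff_eq_mul₀ (hs v)] at h
    rw [h]
    nth_rw 2 [← Real.mul_self_sqrt (G.degree_nonneg v)]
    field_simp [hs v]

/-- The energy of an eigenfunction is `λ` times a positive number, so `λ ≥ 0`; `λ ≠ 0` holds by the
choice of eigenvalues. -/
theorem lam_pos {G : WeightedGraph V} (hG : G.Connected) : 0 < G.lam := by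
  obtain ⟨f, hf, hLf⟩ := exists_eigenfunction hG
  have h1 : G.energy f = G.lam * ∑ v, G.degree v * f v ^ 2 := by
    rw [← dotProduct_laplacian_mulVec_self, Finset.mul_sum]
    refine Finset.sum_congr rfl fun v _ => ?_
    rw [hLf]; ring
  obtain ⟨w, hw⟩ := Function.ne_iff.1 hf
  have hpos : 0 < ∑ v, G.degree v * f v ^ 2 :=
    Finset.sum_pos' (fun v _ => mul_nonneg (G.degree_nonneg v) (sq_nonneg _))
      ⟨w, Finset.mem_univ w, mul_pos (G.degree_pos hG w) (sq_pos_of_ne_zero hw)⟩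
  have h2 := G.energy_nonneg f
  rw [h1] at h2
  exact lt_of_le_of_ne (nonneg_of_mul_nonneg_left h2 hpos) (G.isLeast_lam hG).1.1.symm

/-- The constant `1` pairs to zero with `L f`, and `λ ≠ 0`. -/
theorem sum_degree_mul_eigenfunction {G : WeightedGraph V} (hG : G.Connected) {f : V → ℝ}
    (hLf : ∀ v, (G.laplacian *ᵥ f) v = G.lam * (G.degree v * f v)) :
    ∑ v, G.degree v * f v = 0 := by
  have h := G.dotProduct_laplacian_mulVec (fun _ => 1) f
  simp only [dotProduct, hLf, one_mul, sub_self, zero_mul, mul_zero, Finset.sum_const_zero,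
    zero_div, ← Finset.mul_sum] at h
  exact (mul_eq_zero.1 h).resolve_left (lam_pos hG).ne'

/-! ### The two bounds -/

/-- The lower bound, with constant `16`, from an eigenfunction whose positive part is supported on
at most half of the volume. -/
theorem exists_le_Reff_of_eigenfunction {G : WeightedGraph V} (hG : G.Connected) {f : V → ℝ}
    (hf : f ≠ 0) (hLf : ∀ v, (G.laplacian *ᵥ f) v = G.lam * (G.degree v * f v))
    (hvol : G.vol {v | 0 < f v} ≤ G.vol {v | f v ≤ 0}) :
    ∃ S₁ S₂ : Finset V, S₁.Nonempty ∧ S₂.Nonempty ∧ Disjoint S₁ S₂ ∧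
      1 / (16 * G.lam * min (G.vol S₁) (G.vol S₂)) ≤ G.Reff S₁ S₂ := by
  obtain ⟨⟨w, hw⟩, z, hz⟩ := exists_pos_and_nonpos hG hf (sum_degree_mul_eigenfunction hG hLf)
  set g : V → ℝ := fun v => max (f v) 0 with hg
  obtain ⟨τ, hτ, ⟨y, hy⟩, hE⟩ := G.exists_slice_energy_le (lam_pos hG).le (g := g)
    (fun v => le_max_right _ _) (w := w) (lt_max_of_lt_left hw) (energy_posPart_le hLf)
  set S₁ : Finset V := {v | 2 * τ ≤ g v} with hS₁
  set S₂ : Finset V := {v | g v ≤ τ} with hS₂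
  have hne₁ : S₁.Nonempty := ⟨y, by simpa [hS₁] using hy⟩
  have hne₂ : S₂.Nonempty := ⟨z, by simp [hS₂, hg, hz.trans hτ.le, hτ.le]⟩
  have hdisj : Disjoint S₁ S₂ := by
    rw [Finset.disjoint_left]
    intro v h1 h2
    simp only [hS₁, hS₂, Finset.mem_filter, Finset.mem_univ, true_and] at h1 h2
    linarith
  -- `S₁ ⊆ {f > 0}` and `{f ≤ 0} ⊆ S₂`, so `hvol` makes `S₁` the smaller side.
  have hle : G.vol S₁ ≤ G.vol S₂ := by
    refine (G.vol_mono fun v hv => ?_).trans (hvol.trans (G.vol_mono fun v hv => ?_))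
    · simp only [hS₁, Finset.mem_filter, Finset.mem_univ, true_and] at hv ⊢
      by_contra h
      rw [hg] at hv
      simp only [max_eq_right (not_lt.1 h)] at hv
      linarith
    · simp only [hS₂, Finset.mem_filter, Finset.mem_univ, true_and] at hv ⊢
      simp only [hg, max_eq_right hv, hτ.le]
  have hpos : 0 < G.vol S₁ := Finset.sum_pos (fun v _ => G.degree_pos hG v) hne₁
  refine ⟨S₁, S₂, hne₁, hne₂, hdisj, ?_⟩
  have hR := one_le_Reff_mul_energy hG hne₁ hne₂ hdisj
    (f := fun v => τ⁻¹ * (min (g v) (2 * τ) - min (g v) τ)) (fun v hv => ?_) (fun v hv => ?_)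
  · rw [energy_mul_left] at hR
    have hE' : τ⁻¹ ^ 2 * G.energy (fun v => min (g v) (2 * τ) - min (g v) τ) ≤
        16 * G.lam * G.vol S₁ := by
      refine (mul_le_mul_of_nonneg_left hE (by positivity)).trans_eq ?_
      field_simp
    have hlam := lam_pos hG
    rw [min_eq_left hle, div_le_iff₀ (by positivity)]
    refine hR.trans (mul_le_mul_of_nonneg_left hE' ?_)
    obtain ⟨φ, a, b, -, -, hRab, hEab⟩ := exists_energy_eq_Reff hG hne₁ hne₂ hdisj
    rw [hRab, ← hEab]
    exact G.energy_nonneg φ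
  · simp only [hS₁, Finset.mem_filter, Finset.mem_univ, true_and] at hv
    rw [min_eq_right hv, min_eq_right (by linarith)]
    field_simp
    norm_num
  · simp only [hS₂, Finset.mem_filter, Finset.mem_univ, true_and] at hv
    rw [min_eq_left hv, min_eq_left (by linarith), sub_self, mul_zero]

/-- Either `f` or `-f` meets the volume condition; `f = 0` counts on the nonpositive side for both.
-/
theorem exists_le_Reff {G : WeightedGraph V} (hG : G.Connected) :
    ∃ S₁ S₂ : Finset V, S₁.Nonempty ∧ S₂.Nonempty ∧ Disjoint S₁ S₂ ∧
      1 / (16 * G.lam * min (G.vol S₁) (G.vol S₂)) ≤ G.Reff S₁ S₂ := by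
  obtain ⟨f, hf, hLf⟩ := exists_eigenfunction hG
  rcases le_total (G.vol {v | 0 < f v}) (G.vol {v | f v ≤ 0}) with h | h
  · exact exists_le_Reff_of_eigenfunction hG hf hLf h
  · refine exists_le_Reff_of_eigenfunction hG (f := -f) (neg_ne_zero.2 hf) (fun v => ?_) ?_
    · rw [Matrix.mulVec_neg, Pi.neg_apply, Pi.neg_apply, hLf]; ring
    · refine (G.vol_mono fun v hv => ?_).trans (h.trans (G.vol_mono fun v hv => ?_))
      · simp only [Finset.mem_filter, Finset.mem_univ, true_and, Pi.neg_apply] at hv ⊢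
        linarith
      · simp only [Finset.mem_filter, Finset.mem_univ, true_and, Pi.neg_apply] at hv ⊢
        linarith

theorem Reff_le {G : WeightedGraph V} (hG : G.Connected) {A B : Finset V}
    (hA : A.Nonempty) (hB : B.Nonempty) (hAB : Disjoint A B) :
    G.Reff A B ≤ 2 / (G.lam * min (G.vol A) (G.vol B)) := by
  obtain ⟨f, a, b, hfA, hfB, hR, hE⟩ := exists_energy_eq_Reff hG hA hB hAB
  obtain ⟨c, hc⟩ := exists_lam_mul_le_energy hG f
  have hlam := lam_pos hG
  set m := min (G.vol A) (G.vol B)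
  have hm : 0 < m := lt_min (Finset.sum_pos (fun v _ => G.degree_pos hG v) hA)
    (Finset.sum_pos (fun v _ => G.degree_pos hG v) hB)
  have hsum : m * (a - c) ^ 2 + m * (b - c) ^ 2 ≤ ∑ v, G.degree v * (f v - c) ^ 2 := by
    calc m * (a - c) ^ 2 + m * (b - c) ^ 2
        ≤ G.vol A * (a - c) ^ 2 + G.vol B * (b - c) ^ 2 :=
          add_le_add (mul_le_mul_of_nonneg_right (min_le_left _ _) (sq_nonneg _))
            (mul_le_mul_of_nonneg_right (min_le_right _ _) (sq_nonneg _))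
      _ = ∑ v ∈ A ∪ B, G.degree v * (f v - c) ^ 2 := by
          rw [Finset.sum_union hAB, vol, vol, Finset.sum_mul, Finset.sum_mul]
          exact congrArg₂ _ (Finset.sum_congr rfl fun v hv => by rw [hfA v hv])
            (Finset.sum_congr rfl fun v hv => by rw [hfB v hv])
      _ ≤ _ := Finset.sum_le_sum_of_subset_of_nonneg (Finset.subset_univ _)
          fun v _ _ => mul_nonneg (G.degree_nonneg v) (sq_nonneg _)
  -- This holds for every `c`, so the Poincaré constant need not be identified.
  have hsq : (a - b) ^ 2 / 2 ≤ (a - c) ^ 2 + (b - c) ^ 2 := by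
    linarith [sq_nonneg ((a - c) + (b - c)),
      show (a - b) ^ 2 + ((a - c) + (b - c)) ^ 2 = 2 * ((a - c) ^ 2 + (b - c) ^ 2) by ring]
  have hkey : G.lam * m * ((a - b) ^ 2 / 2) ≤ a - b := by
    rw [hE] at hc
    refine le_trans ?_ hc
    rw [mul_assoc]
    refine mul_le_mul_of_nonneg_left (le_trans ?_ hsum) hlam.le
    rw [← mul_add]
    exact mul_le_mul_of_nonneg_left hsq hm.le
  have h0 : 0 ≤ a - b := hE ▸ G.energy_nonneg f
  rw [hR, le_div_iff₀ (by positivity)]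
  rcases h0.eq_or_lt with h | h
  · rw [← h, zero_mul]; norm_num
  · refine le_of_mul_le_mul_right ?_ h
    linarith [show (a - b) * (G.lam * m) * (a - b) = 2 * (G.lam * m * ((a - b) ^ 2 / 2)) by ring]

end WeightedGraph

theorem theorem3 {V : Type*} [Fintype V] [DecidableEq V] [Nontrivial V]
    (G : WeightedGraph V) (hG : G.Connected) :
    (∃ S₁ S₂ : Finset V, S₁.Nonempty ∧ S₂.Nonempty ∧ Disjoint S₁ S₂ ∧
      1 / (25600 * G.lam * min (G.vol S₁) (G.vol S₂)) ≤ G.Reff S₁ S₂) ∧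
    (∀ S₁' S₂' : Finset V, S₁'.Nonempty → S₂'.Nonempty → Disjoint S₁' S₂' →
      G.Reff S₁' S₂' ≤ 2 / (G.lam * min (G.vol S₁') (G.vol S₂'))) := by
  refine ⟨?_, fun A B hA hB hAB => WeightedGraph.Reff_le hG hA hB hAB⟩
  obtain ⟨A, B, hA, hB, hAB, h⟩ := WeightedGraph.exists_le_Reff hG
  refine ⟨A, B, hA, hB, hAB, le_trans ?_ h⟩
  have hm : 0 < min (G.vol A) (G.vol B) :=
    lt_min (Finset.sum_pos (fun v _ => G.degree_pos hG v) hA)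
      (Finset.sum_pos (fun v _ => G.degree_pos hG v) hB)
  have hlam := WeightedGraph.lam_pos hG
  gcongr
  norm_num
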